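/- Let $\mathbb T=\mathbb R/\mathbb Z$, let $f:\mathbb T\to\mathbb R$ be Lipschitz, and let $\alpha\in\mathbb R\setminus\mathbb Q$. For $\theta\in\mathbb T$ let $H_{\alpha,\theta}$ be the bounded self-adjoint operator on $\ell^2(\mathbb Z)$ given by $$(H_{\alpha,\theta}\psi)(n)=\psi(n-1)+\psi(n+1)+f(\theta+n\alpha)\psi(n).$$ Let $\mu_{\alpha,\theta}=\mu_{\delta_0,\delta_0}+\mu_{\delta_1,\delta_1}$ be its canonical spectral measure, where $\delta_k$ is the $k$-th canonical basis vector and $\mu_{\psi,\psi}$ is the Borel measure on $\mathbb R$ with $\langle\psi,g(H_{\alpha,\theta})\psi\rangle=\int g\,d\mu_{\psi,\psi}$ for all continuous compactly supported $g$. Let $$\gamma(E)=\lim_{n\to\infty}\frac1n\int_{\mathbb T}\log\|\Phi_{\alpha,\theta,[0,n-1]}(E)\|\,d\theta$$ be the Lyapunov exponent, where $$\Phi_{\alpha,\theta,[0,n-1]}(E)=T_{\alpha,\theta,E}(n-1)\cdots T_{\alpha,\theta,E}(0),\qquad T_{\alpha,\theta,E}(k)=\begin{pmatrix}E-f(\theta+k\alpha)&-1\\1&0\end{pmatrix}.$$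 Let $p_m\in\mathbb Z$ and $q_m\in\mathbb N$, $q_m\ge1$, be sequences with $p_m/q_m\to\alpha$, let $\beta>0$, and suppose that $|\alpha-p_m/q_m|<e^{-\beta q_m}$ for every $m$. If $E\in\mathbb R$ satisfies $2\gamma(E)<\beta$, then for every $\theta\in\mathbb T$ the number $E$ is not an eigenvalue of $H_{\alpha,\theta}$ on $\ell^2(\mathbb Z)$, and $$\sup_{\theta\in\mathbb T}\mu_{\alpha,\theta}(\{E\})=0.$$ -/

import Mathlib

open MeasureTheory Filter Topology
open scoped InnerProductSpace BoundedContinuousFunction CompactlySupported NNReal ENNReal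

noncomputable section

namespace QPSchrodinger

/-! ### Bounded discrete Schrödinger operators on `ℓ²(ℤ)` -/

/-- The complex Hilbert space `ℓ²(ℤ)`. -/
abbrev L2Z : Type := lp (fun _ : ℤ => ℂ) 2

/-- The canonical basis vector `δ_k` of `ℓ²(ℤ)`. -/
def delta (k : ℤ) : L2Z := lp.single 2 k 1

lemma memlp_translate (k : ℤ) (x : L2Z) : Memℓp (fun n : ℤ => x (n + k)) 2 := by
  have h := (memℓp_gen_iff (p := 2) (by norm_num)).1 (lp.memℓp x)
  exact (memℓp_gen_iff (p := 2) (by norm_num)).2 ((Equiv.addRight k).summable_iff.2 h)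

lemma memlp_mul (V : ℤ →ᵇ ℝ) (x : L2Z) : Memℓp (fun n : ℤ => (V n : ℂ) * x n) 2 := by
  refine (lp.memℓp ((‖V‖ : ℂ) • x)).mono' fun n => ?_
  change ‖(V n : ℂ) * x n‖ ≤ ‖(‖V‖ : ℂ) * x n‖
  rw [norm_mul, norm_mul]
  refine mul_le_mul_of_nonneg_right ?_ (norm_nonneg _)
  simpa using V.norm_coe_le_norm n

/-- The translation `(S_k ψ)(n) = ψ(n + k)` on `ℓ²(ℤ)`. -/
def translate (k : ℤ) : L2Z →L[ℂ] L2Z :=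
  LinearMap.mkContinuous
    { toFun := fun x => ⟨fun n => x (n + k), memlp_translate k x⟩
      map_add' := fun _ _ => rfl
      map_smul' := fun _ _ => rfl } 1 (by
    intro x
    rw [one_mul]
    refine le_of_eq ?_
    rw [lp.norm_eq_tsum_rpow (by norm_num), lp.norm_eq_tsum_rpow (by norm_num)]
    congr 1
    exact (Equiv.addRight k).tsum_eq (fun n : ℤ => ‖x n‖ ^ (2 : ℝ≥0∞).toReal))

/-- Multiplication by a bounded real potential on `ℓ²(ℤ)`. -/
def mulPotential (V : ℤ →ᵇ ℝ) : L2Z →L[ℂ] L2Z :=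
  LinearMap.mkContinuous
    { toFun := fun x => ⟨fun n => (V n : ℂ) * x n, memlp_mul V x⟩
      map_add' := fun x y => by ext n; exact mul_add _ _ _
      map_smul' := fun c x => by ext n; exact mul_left_comm _ _ _ } ‖V‖ (by
    intro x
    have hx : ‖(‖V‖ : ℂ) • x‖ = ‖V‖ * ‖x‖ := by
      rw [lp.norm_const_smul (by norm_num)]
      simp
    rw [← hx]
    refine lp.norm_mono (by norm_num) fun n => ?_
    change ‖(V n : ℂ) * x n‖ ≤ ‖(‖V‖ : ℂ) * x n‖
    rw [norm_mul, norm_mul]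
    gcongr
    simpa using V.norm_coe_le_norm n)

/-- The bounded discrete Schrödinger operator `Δ + V` on `ℓ²(ℤ)`. -/
def schrodinger (V : ℤ →ᵇ ℝ) : L2Z →L[ℂ] L2Z :=
  translate (-1) + translate 1 + mulPotential V

lemma schrodinger_apply (V : ℤ →ᵇ ℝ) (ψ : L2Z) (n : ℤ) :
    schrodinger V ψ n = ψ (n - 1) + ψ (n + 1) + (V n : ℂ) * ψ n := rfl

lemma inner_translate (k : ℤ) (x y : L2Z) :
    ⟪translate k x, y⟫_ℂ = ⟪x, translate (-k) y⟫_ℂ := by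
  rw [lp.inner_eq_tsum, lp.inner_eq_tsum,
    ← (Equiv.addRight k).tsum_eq (fun n : ℤ => ⟪x n, translate (-k) y n⟫_ℂ)]
  refine tsum_congr fun n => ?_
  change ⟪x (n + k), y n⟫_ℂ = ⟪x (n + k), y (n + k + -k)⟫_ℂ
  rw [add_neg_cancel_right]

lemma isSelfAdjoint_schrodinger (V : ℤ →ᵇ ℝ) : IsSelfAdjoint (schrodinger V) := by
  rw [ContinuousLinearMap.isSelfAdjoint_iff_isSymmetric]
  intro x y
  change ⟪translate (-1) x + translate 1 x + mulPotential V x, y⟫_ℂ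
    = ⟪x, translate (-1) y + translate 1 y + mulPotential V y⟫_ℂ
  have hm : ⟪mulPotential V x, y⟫_ℂ = ⟪x, mulPotential V y⟫_ℂ := by
    rw [lp.inner_eq_tsum, lp.inner_eq_tsum]
    refine tsum_congr fun n => ?_
    change ⟪(V n : ℂ) * x n, y n⟫_ℂ = ⟪x n, (V n : ℂ) * y n⟫_ℂ
    simp [mul_left_comm, mul_comm]
  rw [inner_add_left, inner_add_left, inner_add_right, inner_add_right, inner_translate,
    inner_translate, hm, neg_neg, add_comm ⟪x, translate 1 y⟫_ℂ]

/-! ### Spectral measures of bounded self-adjoint operators -/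

section Spectral

variable {H : Type*} [NormedAddCommGroup H] [InnerProductSpace ℂ H] [CompleteSpace H]

/-- The positive functional `g ↦ ⟨ψ, g(A) ψ⟩` on compactly supported continuous functions, where
`g(A)` is given by the continuous functional calculus of the self-adjoint operator `A`. -/
def spectralFunctional (A : H →L[ℂ] H) (_hA : IsSelfAdjoint A) (ψ : H) :
    C_c(ℝ, ℝ) →ₚ[ℝ] ℝ :=
  PositiveLinearMap.mk₀
    { toFun := fun g => (⟪ψ, cfc (g : ℝ → ℝ) A ψ⟫_ℂ).re
      map_add' := fun g h => by
        have : cfc ((g + h : C_c(ℝ, ℝ)) : ℝ → ℝ) A = cfc (g : ℝ → ℝ) A + cfc (h : ℝ → ℝ) A :=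
          cfc_add A g h g.continuous.continuousOn h.continuous.continuousOn
        rw [this]
        simp
      map_smul' := fun c g => by
        have : cfc ((c • g : C_c(ℝ, ℝ)) : ℝ → ℝ) A = c • cfc (g : ℝ → ℝ) A :=
          cfc_smul c g A g.continuous.continuousOn
        rw [this]
        simp [inner_smul_right_eq_smul] }
    (fun g hg => by
      have h : 0 ≤ cfc (g : ℝ → ℝ) A := cfc_nonneg fun x _ => hg x
      have h2 := (ContinuousLinearMap.nonneg_iff_isPositive _).1 h
      exact h2.re_inner_nonneg_right ψ)

/-- The spectral measure `μ_{ψ,ψ}` of the bounded self-adjoint operator `A`: the Borel measure on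
`ℝ` that represents `g ↦ ⟨ψ, g(A) ψ⟩`, obtained from the Riesz–Markov–Kakutani theorem. -/
def spectralMeasure (A : H →L[ℂ] H) (hA : IsSelfAdjoint A) (ψ : H) : Measure ℝ :=
  RealRMK.rieszMeasure (spectralFunctional A hA ψ)

lemma integral_spectralMeasure (A : H →L[ℂ] H) (hA : IsSelfAdjoint A) (ψ : H) (g : C_c(ℝ, ℝ)) :
    ((∫ x, g x ∂(spectralMeasure A hA ψ) : ℝ) : ℂ) = ⟪ψ, cfc (g : ℝ → ℝ) A ψ⟫_ℂ := by
  have h1 : ∫ x, g x ∂(spectralMeasure A hA ψ) = (⟪ψ, cfc (g : ℝ → ℝ) A ψ⟫_ℂ).re :=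
    RealRMK.integral_rieszMeasure (spectralFunctional A hA ψ) g
  have h2 : IsSelfAdjoint (cfc (g : ℝ → ℝ) A) := cfc_predicate _ A
  have h3 := (ContinuousLinearMap.isSelfAdjoint_iff_isSymmetric.1 h2) ψ ψ
  rw [h1]
  refine Complex.conj_eq_iff_re.1 ?_
  rw [inner_conj_symm]
  exact h3

end Spectral

/-! ### Quasiperiodic operators and the Lyapunov exponent -/

/-- The quasiperiodic potential `n ↦ f(θ + nα)`. -/
def potential (f : C(UnitAddCircle, ℝ)) (α : ℝ) (θ : UnitAddCircle) : ℤ →ᵇ ℝ :=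
  BoundedContinuousFunction.ofNormedAddCommGroupDiscrete
    (fun n : ℤ => f (θ + n • (α : UnitAddCircle))) ‖f‖ (fun _ => f.norm_coe_le_norm _)

/-- The operator `H_{α,θ}` on `ℓ²(ℤ)`,
`(H_{α,θ} ψ)(n) = ψ(n-1) + ψ(n+1) + f(θ + nα) ψ(n)`. -/
def hamiltonian (f : C(UnitAddCircle, ℝ)) (α : ℝ) (θ : UnitAddCircle) : L2Z →L[ℂ] L2Z :=
  schrodinger (potential f α θ)

lemma hamiltonian_apply (f : C(UnitAddCircle, ℝ)) (α : ℝ) (θ : UnitAddCircle) (ψ : L2Z) (n : ℤ) :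
    hamiltonian f α θ ψ n
      = ψ (n - 1) + ψ (n + 1) + (f (θ + n • (α : UnitAddCircle)) : ℂ) * ψ n := rfl

/-- The canonical spectral measure `μ_{α,θ} = μ_{δ₀,δ₀} + μ_{δ₁,δ₁}` of `H_{α,θ}`. -/
def canonicalSpectralMeasure (f : C(UnitAddCircle, ℝ)) (α : ℝ) (θ : UnitAddCircle) : Measure ℝ :=
  spectralMeasure (hamiltonian f α θ) (isSelfAdjoint_schrodinger _) (delta 0)
    + spectralMeasure (hamiltonian f α θ) (isSelfAdjoint_schrodinger _) (delta 1)

/-- The one-step transfer matrix at site `n`. -/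
def transferStep (f : C(UnitAddCircle, ℝ)) (α E : ℝ) (θ : UnitAddCircle) (n : ℕ) :
    Matrix (Fin 2) (Fin 2) ℝ :=
  !![E - f (θ + n • (α : UnitAddCircle)), -1; 1, 0]

/-- The `n`-step transfer matrix `Φ_{α,θ,[0,n-1]}(E) = T(n-1) ⋯ T(0)`. -/
def transferMatrix (f : C(UnitAddCircle, ℝ)) (α E : ℝ) (θ : UnitAddCircle) :
    ℕ → Matrix (Fin 2) (Fin 2) ℝ
  | 0 => 1
  | n + 1 => transferStep f α E θ n * transferMatrix f α E θ n

/-- The operator norm of a real `2 × 2` matrix acting on the Euclidean plane. -/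
def opNorm (A : Matrix (Fin 2) (Fin 2) ℝ) : ℝ :=
  ‖Matrix.toEuclideanCLM (n := Fin 2) (𝕜 := ℝ) A‖

/-- `∫_𝕋 log ‖Φ_{α,θ,[0,n-1]}(E)‖ dθ`, with respect to the Lebesgue probability measure on `𝕋`. -/
def logNormIntegral (f : C(UnitAddCircle, ℝ)) (α E : ℝ) (n : ℕ) : ℝ :=
  ∫ θ : UnitAddCircle, Real.log (opNorm (transferMatrix f α E θ n))

/-- The Lyapunov exponent `γ(E) = lim (1/n) ∫_𝕋 log ‖Φ_{α,θ,[0,n-1]}(E)‖ dθ`; the limit exists by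
`tendsto_lyapunovExponent`. -/
def lyapunovExponent (f : C(UnitAddCircle, ℝ)) (α E : ℝ) : ℝ :=
  limUnder atTop fun n : ℕ => logNormIntegral f α E n / n

lemma det_transferMatrix (f : C(UnitAddCircle, ℝ)) (α E : ℝ) (θ : UnitAddCircle) (n : ℕ) :
    (transferMatrix f α E θ n).det = 1 := by
  induction n with
  | zero => simp [transferMatrix]
  | succ n ih => rw [transferMatrix, Matrix.det_mul, ih]; simp [transferStep, Matrix.det_fin_two]

lemma transferMatrix_add (f : C(UnitAddCircle, ℝ)) (α E : ℝ) (θ : UnitAddCircle) (m n : ℕ) :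
    transferMatrix f α E θ (m + n)
      = transferMatrix f α E (θ + m • (α : UnitAddCircle)) n * transferMatrix f α E θ m := by
  induction n with
  | zero => simp [transferMatrix]
  | succ n ih =>
    rw [← add_assoc, transferMatrix, ih, transferMatrix, Matrix.mul_assoc, transferStep,
      transferStep, add_smul, add_assoc]

lemma continuous_transferMatrix (f : C(UnitAddCircle, ℝ)) (α E : ℝ) (n : ℕ) :
    Continuous fun θ => transferMatrix f α E θ n := by
  induction n with
  | zero => exact continuous_const
  | succ n ih =>
    refine Continuous.matrix_mul ?_ ih
    refine continuous_matrix fun i j => ?_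
    fin_cases i <;> fin_cases j <;> simp [transferStep] <;> fun_prop

lemma one_le_opNorm (A : Matrix (Fin 2) (Fin 2) ℝ) (hA : A.det = 1) : 1 ≤ opNorm A := by
  have key : ∀ j, A 0 j ^ 2 + A 1 j ^ 2 ≤ opNorm A ^ 2 := fun j => by
    have h := (Matrix.toEuclideanCLM (n := Fin 2) (𝕜 := ℝ) A).le_opNorm
      (EuclideanSpace.single j 1)
    have h2 := pow_le_pow_left₀ (norm_nonneg _) h 2
    rw [PiLp.norm_single, EuclideanSpace.norm_sq_eq] at h2
    simpa [opNorm, Fin.sum_univ_two] using h2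
  have h0 := key 0
  have h1 := key 1
  rw [Matrix.det_fin_two] at hA
  have hn : 0 ≤ opNorm A := norm_nonneg _
  nlinarith [sq_nonneg (A 0 0 - A 1 1), sq_nonneg (A 0 1 + A 1 0)]

lemma continuous_log_opNorm (f : C(UnitAddCircle, ℝ)) (α E : ℝ) (n : ℕ) :
    Continuous fun θ => Real.log (opNorm (transferMatrix f α E θ n)) := by
  have hc : Continuous (Matrix.toEuclideanCLM (n := Fin 2) (𝕜 := ℝ)) :=
    (Matrix.toEuclideanCLM (n := Fin 2) (𝕜 := ℝ)).toAlgEquiv.toLinearMap.continuous_of_finiteDimensional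
  refine Continuous.log (hc.comp (continuous_transferMatrix f α E n)).norm fun θ => ?_
  have := one_le_opNorm _ (det_transferMatrix f α E θ n)
  exact (zero_lt_one.trans_le this).ne'

lemma subadditive_logNormIntegral (f : C(UnitAddCircle, ℝ)) (α E : ℝ) :
    Subadditive (logNormIntegral f α E) := by
  intro m n
  have hi : ∀ k, Integrable
      (fun θ : UnitAddCircle => Real.log (opNorm (transferMatrix f α E θ k))) := fun k =>
    (continuous_log_opNorm f α E k).integrable_of_hasCompactSupport
      (HasCompactSupport.of_compactSpace _)
  have hshift : logNormIntegral f α E n = ∫ θ : UnitAddCircle,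
      Real.log (opNorm (transferMatrix f α E (θ + m • (α : UnitAddCircle)) n)) :=
    (integral_add_right_eq_self
      (fun θ : UnitAddCircle => Real.log (opNorm (transferMatrix f α E θ n))) _).symm
  rw [add_comm (logNormIntegral f α E m), hshift, logNormIntegral, logNormIntegral,
    ← integral_add ((hi n).comp_add_right _) (hi m)]
  refine integral_mono (hi _) (((hi n).comp_add_right _).add (hi m)) fun θ => ?_
  have h1 := one_le_opNorm _ (det_transferMatrix f α E (θ + m • (α : UnitAddCircle)) n)
  have h2 := one_le_opNorm _ (det_transferMatrix f α E θ m)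
  have h3 := one_le_opNorm _ (det_transferMatrix f α E θ (m + n))
  change Real.log _ ≤ Real.log _ + Real.log _
  rw [← Real.log_mul (by positivity) (by positivity)]
  refine Real.log_le_log (by positivity) ?_
  rw [transferMatrix_add, opNorm, map_mul]
  exact norm_mul_le _ _

lemma tendsto_lyapunovExponent (f : C(UnitAddCircle, ℝ)) (α E : ℝ) :
    Tendsto (fun n : ℕ => logNormIntegral f α E n / n) atTop (𝓝 (lyapunovExponent f α E)) := by
  refine tendsto_nhds_limUnder ⟨_, (subadditive_logNormIntegral f α E).tendsto_lim ⟨0, ?_⟩⟩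
  rintro _ ⟨n, rfl⟩
  exact div_nonneg (integral_nonneg fun θ =>
    Real.log_nonneg (one_le_opNorm _ (det_transferMatrix f α E θ n))) n.cast_nonneg

end QPSchrodinger

end

/-! Both conclusions reduce to one fact: $H_{\alpha,\theta}\psi=E\psi$ has no nonzero solution in
$\ell^2(\mathbb Z)$. That this excludes an atom at $E$ is `spectralMeasure_singleton_eq_zero`: for
tents $g_k$ shrinking to the point $E$, the vectors $g_k(A)\psi$ converge to a solution of $Aw=Ew$.
So $w=0$, and $\mu_{\psi,\psi}(\{E\})\le\langle\psi,g_k(A)\psi\rangle\to0$.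

The eigenvalue part is Gordon's argument. Let $q=q_m$ and let $A',A,A''$ be the $q$-step transfer
matrices from the sites $-q,0,q$. Their phases differ by $q\alpha$, which is within $qe^{-\beta q}$
of an integer. For any $\Lambda>\gamma(E)$, transfer matrices are bounded by $Ce^{\Lambda n}$
uniformly in the phase (`exists_forall_opNorm_transferMatrix_le`, from subadditivity and uniform
Weyl equidistribution). A telescoping sum in which this bound is applied to whole products
(`opNorm_transferMatrix_sub_le`) then gives $\|A-A'\|,\|A-A''\|\lesssim q^2e^{-(\beta-\Lambda)q}$,
which tends to $0$ once $\gamma<\Lambda<\beta$. Cayley–Hamilton for these determinant-one matrices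
(`norm_le_of_three_block`) bounds the state at $0$ by the states at $-q,q,2q$ plus a vanishing
multiple of itself. Decay of the solution forces the state at $0$ to vanish.

Only single blocks are compared, never their squares, so $\gamma<\beta$ suffices; it follows from
$2\gamma<\beta$ because $\gamma\ge0$. -/

namespace QPSchrodinger

/-! ### Atoms of spectral measures are eigenvalues -/

/-- The tent function of height `1` centred at `E`, with slopes `±(k + 1)`. -/
noncomputable def tent (E : ℝ) (k : ℕ) : C_c(ℝ, ℝ) where
  toFun x := max 0 (1 - (k + 1) * |x - E|)
  continuous_toFun := by fun_prop
  hasCompactSupport' := by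
    refine HasCompactSupport.of_support_subset_isCompact (isCompact_closedBall E 1) fun x hx => ?_
    rw [Metric.mem_closedBall, Real.dist_eq]
    by_contra! h
    refine hx (max_eq_left ?_)
    have : (0 : ℝ) ≤ k := k.cast_nonneg
    nlinarith

lemma tent_apply (E : ℝ) (k : ℕ) (x : ℝ) : tent E k x = max 0 (1 - (k + 1) * |x - E|) := rfl

lemma tent_nonneg (E : ℝ) (k : ℕ) (x : ℝ) : 0 ≤ tent E k x := le_max_left _ _

lemma tent_le_one (E : ℝ) (k : ℕ) (x : ℝ) : tent E k x ≤ 1 := by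
  rw [tent_apply]
  exact max_le zero_le_one (by have := abs_nonneg (x - E); nlinarith [k.cast_nonneg (α := ℝ)])

lemma tent_self (E : ℝ) (k : ℕ) : tent E k E = 1 := by simp [tent_apply]

lemma tent_antitone (E : ℝ) {k l : ℕ} (h : k ≤ l) (x : ℝ) : tent E l x ≤ tent E k x := by
  rw [tent_apply, tent_apply]
  gcongr

lemma abs_sub_mul_tent_le (E : ℝ) (k : ℕ) (x : ℝ) : |(x - E) * tent E k x| ≤ 1 / (k + 1) := by
  have hk : (0 : ℝ) < k + 1 := by positivity
  rw [abs_mul, abs_of_nonneg (tent_nonneg E k x), le_div_iff₀ hk]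
  rcases le_total ((k + 1) * |x - E|) 1 with h | h
  · calc |x - E| * tent E k x * (k + 1) ≤ |x - E| * 1 * (k + 1) := by
          gcongr; exact tent_le_one E k x
      _ ≤ 1 := by linarith
  · rw [tent_apply, max_eq_left (by linarith)]
    simp

section Spectral

variable {H : Type*} [NormedAddCommGroup H] [InnerProductSpace ℂ H] [CompleteSpace H]

lemma re_inner_cfc_mono (A : H →L[ℂ] H) (ψ : H) {g h : ℝ → ℝ} (hg : Continuous g)
    (hh : Continuous h) (hgh : ∀ x, g x ≤ h x) :
    (⟪ψ, cfc g A ψ⟫_ℂ).re ≤ (⟪ψ, cfc h A ψ⟫_ℂ).re := by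
  have h1 : cfc g A ≤ cfc h A :=
    cfc_mono (fun x _ => hgh x) hg.continuousOn hh.continuousOn
  have h2 := ((ContinuousLinearMap.le_def _ _).1 h1).re_inner_nonneg_right ψ
  simpa [inner_sub_right] using h2

lemma norm_sq_cfc_apply (A : H →L[ℂ] H) (ψ : H) {g : ℝ → ℝ} (hg : Continuous g) :
    ‖cfc g A ψ‖ ^ 2 = (⟪ψ, cfc (fun x => g x * g x) A ψ⟫_ℂ).re := by
  have h2 : IsSelfAdjoint (cfc g A) := cfc_predicate _ A
  rw [cfc_mul g g A hg.continuousOn hg.continuousOn]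
  have h3 := (ContinuousLinearMap.isSelfAdjoint_iff_isSymmetric.1 h2) ψ (cfc g A ψ)
  change _ = (⟪ψ, cfc g A (cfc g A ψ)⟫_ℂ).re
  change ⟪cfc g A ψ, cfc g A ψ⟫_ℂ = ⟪ψ, cfc g A (cfc g A ψ)⟫_ℂ at h3
  rw [← h3, inner_self_eq_norm_sq_to_K]
  norm_cast

lemma norm_sub_smul_cfc_tent_le (A : H →L[ℂ] H) (hA : IsSelfAdjoint A) (E : ℝ) (k : ℕ) (ψ : H) :
    ‖A (cfc (tent E k) A ψ) - (E : ℂ) • cfc (tent E k) A ψ‖ ≤ 1 / (k + 1) * ‖ψ‖ := by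
  have hc := (tent E k).continuous
  have h1 : cfc (fun x : ℝ => (x - E) * tent E k x) A = (A - algebraMap ℝ _ E) * cfc (tent E k) A := by
    rw [cfc_mul (fun x : ℝ => x - E) (tent E k) A (by fun_prop) hc.continuousOn,
      cfc_sub (fun x : ℝ => x) (fun _ => E) A, cfc_id' ℝ A, cfc_const E A]
  have h2 : ‖cfc (fun x : ℝ => (x - E) * tent E k x) A‖ ≤ 1 / (k + 1) :=
    norm_cfc_le (by positivity) fun x _ => abs_sub_mul_tent_le E k x
  have h3 : A (cfc (tent E k) A ψ) - (E : ℂ) • cfc (tent E k) A ψ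
      = cfc (fun x : ℝ => (x - E) * tent E k x) A ψ := by
    rw [h1]
    simp [Algebra.algebraMap_eq_smul_one]
  rw [h3]
  exact (ContinuousLinearMap.le_opNorm _ _).trans (by gcongr)

/-- A real number that is not an eigenvalue of a bounded self-adjoint operator is not an atom of
its spectral measures. -/
theorem spectralMeasure_singleton_eq_zero (A : H →L[ℂ] H) (hA : IsSelfAdjoint A) (ψ : H) (E : ℝ)
    (hE : ∀ v, A v = (E : ℂ) • v → v = 0) : spectralMeasure A hA ψ {E} = 0 := by
  set a : ℕ → ℝ := fun k => (⟪ψ, cfc (tent E k) A ψ⟫_ℂ).re with ha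
  set v : ℕ → H := fun k => cfc (tent E k) A ψ with hv
  have ha_anti : Antitone a := fun k l h =>
    re_inner_cfc_mono A ψ (tent E l).continuous (tent E k).continuous (tent_antitone E h)
  have ha_nonneg : ∀ k, 0 ≤ a k := fun k => by
    have h : 0 ≤ cfc (tent E k : ℝ → ℝ) A := cfc_nonneg fun x _ => tent_nonneg E k x
    exact ((ContinuousLinearMap.nonneg_iff_isPositive _).1 h).re_inner_nonneg_right ψ
  have hbdd : BddBelow (Set.range a) := ⟨0, by rintro _ ⟨k, rfl⟩; exact ha_nonneg k⟩
  have ha_lim := tendsto_atTop_ciInf ha_anti hbdd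
  have hdist : ∀ k l, k ≤ l → ‖v k - v l‖ ^ 2 ≤ a k - a l := fun k l h => by
    have hk := (tent E k).continuous
    have hl := (tent E l).continuous
    have h1 : cfc (fun x => tent E k x - tent E l x) A = cfc (tent E k) A - cfc (tent E l) A :=
      cfc_sub (tent E k) (tent E l) A hk.continuousOn hl.continuousOn
    have h2 : v k - v l = cfc (fun x => tent E k x - tent E l x) A ψ := by rw [h1]; rfl
    have h3 : a k - a l = (⟪ψ, cfc (fun x => tent E k x - tent E l x) A ψ⟫_ℂ).re := by
      rw [h1]; simp [ha]
    rw [h2, h3, norm_sq_cfc_apply A ψ (by fun_prop)]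
    -- The difference $d$ of the two tents satisfies $0\le d\le1$, so $d^2\le d$.
    refine re_inner_cfc_mono A ψ (by fun_prop) (by fun_prop) fun x => ?_
    have := tent_antitone E h x
    exact mul_le_of_le_one_left (by linarith)
      (by linarith [tent_le_one E k x, tent_nonneg E l x])
  have hcauchy : CauchySeq v := by
    rw [Metric.cauchySeq_iff']
    intro ε hε
    obtain ⟨N, hN⟩ := (Metric.tendsto_atTop.1 ha_lim) (ε ^ 2) (by positivity)
    refine ⟨N, fun n hn => ?_⟩
    rw [dist_comm, dist_eq_norm]
    refine lt_of_pow_lt_pow_left₀ 2 hε.le ((hdist N n hn).trans_lt ?_)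
    have h1 := hN N le_rfl
    have h2 := ciInf_le hbdd n
    rw [Real.dist_eq] at h1
    linarith [le_abs_self (a N - ⨅ i, a i)]
  obtain ⟨w, hw⟩ := cauchySeq_tendsto_of_complete hcauchy
  have hw_eigen : A w = (E : ℂ) • w := by
    have h1 : Tendsto (fun k => A (v k) - (E : ℂ) • v k) atTop (𝓝 (A w - (E : ℂ) • w)) :=
      ((A.continuous.tendsto w).comp hw).sub (hw.const_smul _)
    have h2 : Tendsto (fun k => A (v k) - (E : ℂ) • v k) atTop (𝓝 0) := by
      refine squeeze_zero_norm (fun k => norm_sub_smul_cfc_tent_le A hA E k ψ) ?_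
      simpa using tendsto_one_div_add_atTop_nhds_zero_nat.mul_const ‖ψ‖
    exact sub_eq_zero.1 (tendsto_nhds_unique h1 h2)
  rw [hE w hw_eigen] at hw
  have ha_zero : Tendsto a atTop (𝓝 0) := by
    have h : Tendsto (fun k => (⟪ψ, v k⟫_ℂ).re) atTop (𝓝 (⟪ψ, (0 : H)⟫_ℂ).re) :=
      (Complex.continuous_re.tendsto _).comp (tendsto_const_nhds.inner hw)
    simpa using h
  -- The Riesz measure of a compact set is at most the functional on any nonnegative test function
  -- equal to $1$ there.
  have hle : ∀ k, spectralMeasure A hA ψ {E} ≤ ENNReal.ofReal (a k) := fun k =>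
    RealRMK.rieszMeasure_le_of_eq_one (spectralFunctional A hA ψ) (tent_nonneg E k)
      isCompact_singleton (by rintro x rfl; exact tent_self x k)
  have := ge_of_tendsto' (ENNReal.tendsto_ofReal ha_zero) hle
  simpa using this

end Spectral

/-! ### Uniform equidistribution of irrational rotations -/

/-- The Birkhoff averages of `g` along the rotation by `a` converge uniformly to its mean. -/
def UniformlyEquidistributed (a : UnitAddCircle) (g : C(UnitAddCircle, ℂ)) : Prop :=
  ∀ ε > 0, ∀ᶠ n : ℕ in atTop, ∀ θ : UnitAddCircle,
    ‖∑ k ∈ Finset.range n, g (θ + k • a) - n * ∫ x, g x‖ ≤ ε * n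

lemma integrable_continuousMap (g : C(UnitAddCircle, ℂ)) : Integrable fun x => g x :=
  g.continuous.integrable_of_hasCompactSupport (HasCompactSupport.of_compactSpace _)

lemma UniformlyEquidistributed.add {a : UnitAddCircle} {g h : C(UnitAddCircle, ℂ)}
    (hg : UniformlyEquidistributed a g) (hh : UniformlyEquidistributed a h) :
    UniformlyEquidistributed a (g + h) := by
  intro ε hε
  filter_upwards [hg (ε / 2) (half_pos hε), hh (ε / 2) (half_pos hε)] with n h1 h2 θ
  have h3 : ∑ k ∈ Finset.range n, (g + h) (θ + k • a) - n * ∫ x, (g + h) x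
      = (∑ k ∈ Finset.range n, g (θ + k • a) - n * ∫ x, g x)
        + (∑ k ∈ Finset.range n, h (θ + k • a) - n * ∫ x, h x) := by
    simp only [ContinuousMap.add_apply]
    rw [integral_add (integrable_continuousMap g) (integrable_continuousMap h),
      Finset.sum_add_distrib]
    ring
  rw [h3]
  linarith [norm_add_le (∑ k ∈ Finset.range n, g (θ + k • a) - n * ∫ x, g x)
    (∑ k ∈ Finset.range n, h (θ + k • a) - n * ∫ x, h x), h1 θ, h2 θ]

lemma UniformlyEquidistributed.smul {a : UnitAddCircle} {g : C(UnitAddCircle, ℂ)}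
    (hg : UniformlyEquidistributed a g) (c : ℂ) : UniformlyEquidistributed a (c • g) := by
  intro ε hε
  filter_upwards [hg (ε / (‖c‖ + 1)) (by positivity)] with n h1 θ
  have h3 : ∑ k ∈ Finset.range n, (c • g) (θ + k • a) - n * ∫ x, (c • g) x
      = c * (∑ k ∈ Finset.range n, g (θ + k • a) - n * ∫ x, g x) := by
    simp only [ContinuousMap.smul_apply, smul_eq_mul]
    rw [integral_const_mul, ← Finset.mul_sum]
    ring
  rw [h3, norm_mul]
  calc ‖c‖ * ‖∑ k ∈ Finset.range n, g (θ + k • a) - n * ∫ x, g x‖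
      ≤ (‖c‖ + 1) * (ε / (‖c‖ + 1) * n) := by
        gcongr
        · linarith
        · exact h1 θ
    _ = ε * n := by field_simp

/-- An $\varepsilon/3$ argument: a uniform error $\varepsilon/3$ costs at most $n\varepsilon/3$ in
the orbit sum and as much in $n\int g$, whatever the starting point. -/
lemma UniformlyEquidistributed.of_mem_closure {a : UnitAddCircle} {s : Set C(UnitAddCircle, ℂ)}
    (hs : ∀ g ∈ s, UniformlyEquidistributed a g) {g : C(UnitAddCircle, ℂ)} (hg : g ∈ closure s) :
    UniformlyEquidistributed a g := by
  intro ε hε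
  obtain ⟨h, hh, hd⟩ := Metric.mem_closure_iff.1 hg (ε / 3) (by positivity)
  rw [dist_eq_norm] at hd
  have hpt : ∀ x, ‖(g - h) x‖ ≤ ε / 3 := fun x => ((g - h).norm_coe_le_norm x).trans hd.le
  filter_upwards [hs h hh (ε / 3) (by positivity)] with n h1 θ
  have h3 : ∑ k ∈ Finset.range n, g (θ + k • a) - n * ∫ x, g x
      = (∑ k ∈ Finset.range n, (g - h) (θ + k • a) - n * ∫ x, (g - h) x)
        + (∑ k ∈ Finset.range n, h (θ + k • a) - n * ∫ x, h x) := by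
    simp only [ContinuousMap.sub_apply]
    rw [integral_sub (integrable_continuousMap g) (integrable_continuousMap h),
      Finset.sum_sub_distrib]
    ring
  have h4 : ‖∑ k ∈ Finset.range n, (g - h) (θ + k • a)‖ ≤ n * (ε / 3) := by
    refine (norm_sum_le_of_le _ fun k _ => hpt _).trans ?_
    simp
  have h5 : ‖(n : ℂ) * ∫ x, (g - h) x‖ ≤ n * (ε / 3) := by
    rw [norm_mul, Complex.norm_natCast]
    gcongr
    refine (norm_integral_le_of_norm_le_const (μ := volume) (Eventually.of_forall hpt)).trans_eq ?_
    simp [Measure.real]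
  rw [h3]
  refine (norm_add_le _ _).trans ?_
  linarith [norm_sub_le (∑ k ∈ Finset.range n, (g - h) (θ + k • a)) (n * ∫ x, (g - h) x), h1 θ]

lemma fourier_coe_ne_one {α : ℝ} (hα : Irrational α) {k : ℤ} (hk : k ≠ 0) :
    fourier k (α : UnitAddCircle) ≠ 1 := by
  intro h
  rw [fourier_coe_apply, Complex.exp_eq_one_iff] at h
  obtain ⟨m, hm⟩ := h
  have h2 : ((k * α : ℝ) : ℂ) = ((m : ℝ) : ℂ) := by
    have hpi : (2 * Real.pi * Complex.I : ℂ) ≠ 0 := Complex.two_pi_I_ne_zero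
    refine mul_left_cancel₀ hpi ?_
    push_cast at hm ⊢
    rw [div_one] at hm
    linear_combination hm
  exact (hα.intCast_mul hk).ne_int m (by exact_mod_cast h2)

lemma fourier_add_nsmul (k : ℤ) (θ a : UnitAddCircle) (j : ℕ) :
    fourier k (θ + j • a) = fourier k θ * fourier k a ^ j := by
  simp [fourier_apply, AddCircle.toCircle_add, AddCircle.toCircle_nsmul, smul_add,
    smul_comm k j a]

/-- For $k\ne0$ and $z=e^{2\pi ik\alpha}\ne1$, the orbit sum is geometric, hence bounded by
$2/|z-1|$ independently of $n$ and $\theta$, while the mean is $0$. -/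
lemma uniformlyEquidistributed_fourier {α : ℝ} (hα : Irrational α) (k : ℤ) :
    UniformlyEquidistributed (α : UnitAddCircle) (fourier k) := by
  intro ε hε
  rcases eq_or_ne k 0 with rfl | hk
  · refine Eventually.of_forall fun n θ => ?_
    simpa [Measure.real] using mul_nonneg hε.le n.cast_nonneg
  set z : ℂ := fourier k (α : UnitAddCircle) with hz
  have hz1 : z ≠ 1 := fourier_coe_ne_one hα hk
  have hnorm : ∀ x : UnitAddCircle, ‖fourier k x‖ = 1 := fun x => by
    rw [fourier_apply, Circle.norm_coe]
  have hint : ∫ x : UnitAddCircle, fourier k x = 0 := by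
    -- Translation invariance shows that the integral equals $z$ times itself.
    have h1 := integral_add_right_eq_self (μ := volume)
      (fun x : UnitAddCircle => fourier k x) (α : UnitAddCircle)
    have h2 : ∀ x : UnitAddCircle, fourier k (x + (α : UnitAddCircle)) = fourier k x * z :=
      fun x => by
      rw [hz, ← pow_one (fourier k (α : UnitAddCircle)), ← fourier_add_nsmul, one_smul]
    simp only [h2] at h1
    rw [integral_mul_const] at h1
    have h3 : (∫ x : UnitAddCircle, fourier k x) * (z - 1) = 0 := by rw [mul_sub, h1]; ring
    exact (mul_eq_zero.1 h3).resolve_right (sub_ne_zero.2 hz1)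
  have hpos : 0 < ‖z - 1‖ := norm_pos_iff.2 (sub_ne_zero.2 hz1)
  filter_upwards [(tendsto_natCast_atTop_atTop (R := ℝ)).eventually_ge_atTop (2 / ‖z - 1‖ / ε)]
    with n hn θ
  have hsum : ∑ j ∈ Finset.range n, fourier k (θ + j • (α : UnitAddCircle))
      = fourier k θ * ((z ^ n - 1) / (z - 1)) := by
    rw [← geom_sum_eq hz1, Finset.mul_sum]
    exact Finset.sum_congr rfl fun j _ => fourier_add_nsmul k θ α j
  rw [hint, mul_zero, sub_zero, hsum, norm_mul, hnorm, one_mul, norm_div]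
  have h2 : ‖z ^ n - 1‖ ≤ 2 := by
    refine (norm_sub_le _ _).trans ?_
    rw [norm_pow, hz, hnorm]
    norm_num
  rw [div_le_iff₀ hε] at hn
  calc ‖z ^ n - 1‖ / ‖z - 1‖ ≤ 2 / ‖z - 1‖ := by gcongr
    _ ≤ ε * n := by linarith

/-- **Weyl's equidistribution theorem**, uniformly in the starting point. -/
theorem uniformlyEquidistributed_of_irrational {α : ℝ} (hα : Irrational α)
    (g : C(UnitAddCircle, ℂ)) : UniformlyEquidistributed (α : UnitAddCircle) g := by
  refine UniformlyEquidistributed.of_mem_closure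
    (s := (Submodule.span ℂ (Set.range (fourier (T := 1))) : Set C(UnitAddCircle, ℂ)))
    (fun h hh => ?_) ?_
  · induction hh using Submodule.span_induction with
    | mem x hx => obtain ⟨k, rfl⟩ := hx; exact uniformlyEquidistributed_fourier hα k
    | zero =>
      rw [← zero_smul ℂ (fourier 0)]
      exact (uniformlyEquidistributed_fourier hα 0).smul 0
    | add x y _ _ hx hy => exact hx.add hy
    | smul c x _ hx => exact hx.smul c
  · rw [← Submodule.topologicalClosure_coe, span_fourier_closure_eq_top]
    trivial

theorem eventually_sum_rotation_le {α : ℝ} (hα : Irrational α) (g : C(UnitAddCircle, ℝ))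
    {c : ℝ} (hc : ∫ x, g x < c) :
    ∀ᶠ n : ℕ in atTop, ∀ θ : UnitAddCircle,
      ∑ k ∈ Finset.range n, g (θ + k • (α : UnitAddCircle)) ≤ c * n := by
  have h := uniformlyEquidistributed_of_irrational hα
    ⟨fun x => (g x : ℂ), Complex.continuous_ofReal.comp g.continuous⟩ (c - ∫ x, g x)
    (sub_pos.2 hc)
  filter_upwards [h] with n hn θ
  have h1 := hn θ
  simp only [ContinuousMap.coe_mk] at h1
  rw [integral_complex_ofReal] at h1
  have h2 := (Complex.re_le_norm _).trans h1
  have h3 : ((∑ k ∈ Finset.range n, (g (θ + k • (α : UnitAddCircle)) : ℂ))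
      - n * ((∫ x, g x : ℝ) : ℂ)).re
      = ∑ k ∈ Finset.range n, g (θ + k • (α : UnitAddCircle)) - n * ∫ x, g x := by
    norm_cast
  rw [h3] at h2
  linarith

/-! ### Operator norms of `2 × 2` matrices -/

lemma opNorm_nonneg (A : Matrix (Fin 2) (Fin 2) ℝ) : 0 ≤ opNorm A := norm_nonneg _

lemma opNorm_mul_le (A B : Matrix (Fin 2) (Fin 2) ℝ) : opNorm (A * B) ≤ opNorm A * opNorm B := by
  rw [opNorm, map_mul]
  exact norm_mul_le _ _

lemma opNorm_add_le (A B : Matrix (Fin 2) (Fin 2) ℝ) : opNorm (A + B) ≤ opNorm A + opNorm B := by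
  rw [opNorm, map_add]
  exact norm_add_le _ _

lemma opNorm_one : opNorm 1 = 1 := by
  rw [opNorm, map_one]
  exact norm_one

lemma abs_apply_le_opNorm (A : Matrix (Fin 2) (Fin 2) ℝ) (i j : Fin 2) : |A i j| ≤ opNorm A := by
  have h := (Matrix.toEuclideanCLM (n := Fin 2) (𝕜 := ℝ) A).le_opNorm (EuclideanSpace.single j 1)
  rw [PiLp.norm_single, norm_one, mul_one] at h
  refine le_trans ?_ h
  refine le_of_eq_of_le ?_ (PiLp.norm_apply_le _ i)
  simp

lemma abs_trace_le_opNorm (A : Matrix (Fin 2) (Fin 2) ℝ) : |A.trace| ≤ 2 * opNorm A := by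
  rw [Matrix.trace_fin_two]
  linarith [abs_add_le (A 0 0) (A 1 1), abs_apply_le_opNorm A 0 0, abs_apply_le_opNorm A 1 1]

lemma opNorm_corner_le (x : ℝ) : opNorm !![x, 0; 0, 0] ≤ |x| := by
  refine ContinuousLinearMap.opNorm_le_bound _ (abs_nonneg x) fun v => ?_
  have h : Matrix.toEuclideanCLM (n := Fin 2) (𝕜 := ℝ) !![x, 0; 0, 0] v
      = EuclideanSpace.single 0 (x * v 0) := by
    ext i
    fin_cases i <;> simp [Matrix.mulVec, dotProduct]
  rw [h, PiLp.norm_single, norm_mul, Real.norm_eq_abs]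
  gcongr
  exact PiLp.norm_apply_le v 0

lemma mul_self_sub_trace_smul_add_one (A : Matrix (Fin 2) (Fin 2) ℝ) (hA : A.det = 1) :
    A * A - A.trace • A + 1 = 0 := by
  rw [Matrix.det_fin_two] at hA
  ext i j
  fin_cases i <;> fin_cases j <;>
    simp [Matrix.mul_apply, Fin.sum_univ_two, Matrix.trace_fin_two] <;>
    first
    | linear_combination -hA
    | ring

/-! ### A uniform upper bound for transfer matrices -/

lemma lyapunovExponent_nonneg (f : C(UnitAddCircle, ℝ)) (α E : ℝ) :
    0 ≤ lyapunovExponent f α E :=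
  ge_of_tendsto' (tendsto_lyapunovExponent f α E) fun n =>
    div_nonneg (integral_nonneg fun θ =>
      Real.log_nonneg (one_le_opNorm _ (det_transferMatrix f α E θ n))) n.cast_nonneg

lemma exists_opNorm_transferMatrix_le (f : C(UnitAddCircle, ℝ)) (α E : ℝ) (n : ℕ) :
    ∃ B, ∀ θ, opNorm (transferMatrix f α E θ n) ≤ B := by
  obtain ⟨B, hB⟩ := (isCompact_univ (X := UnitAddCircle)).exists_bound_of_continuousOn
    (continuous_log_opNorm f α E n).continuousOn
  refine ⟨Real.exp B, fun θ => ?_⟩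
  have h1 := one_le_opNorm _ (det_transferMatrix f α E θ n)
  rw [← Real.exp_log (zero_lt_one.trans_le h1)]
  exact Real.exp_le_exp.2 ((le_abs_self _).trans (hB θ trivial))

lemma opNorm_transferMatrix_mul_le (f : C(UnitAddCircle, ℝ)) (α E : ℝ) (N M : ℕ)
    (θ : UnitAddCircle) :
    opNorm (transferMatrix f α E θ (N * M)) ≤
      ∏ i ∈ Finset.range M,
        opNorm (transferMatrix f α E (θ + i • ((N * α : ℝ) : UnitAddCircle)) N) := by
  induction M with
  | zero => simp [transferMatrix, opNorm_one]
  | succ M ih =>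
    have h : M • ((N * α : ℝ) : UnitAddCircle) = (N * M) • (α : UnitAddCircle) := by
      rw [← nsmul_eq_mul, AddCircle.coe_nsmul, smul_smul, mul_comm]
    rw [mul_add_one, transferMatrix_add, Finset.prod_range_succ, h, mul_comm (∏ i ∈ _, _)]
    exact (opNorm_mul_le _ _).trans (mul_le_mul_of_nonneg_left ih (opNorm_nonneg _))

/-- Furstenberg's uniform upper bound: over an irrational rotation, transfer matrices grow at most
at any exponential rate above the Lyapunov exponent, uniformly in the phase. -/
theorem exists_forall_opNorm_transferMatrix_le (f : C(UnitAddCircle, ℝ)) {α : ℝ}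
    (hα : Irrational α) (E : ℝ) {Λ : ℝ} (hΛ : lyapunovExponent f α E < Λ) :
    ∃ C, ∀ θ n, opNorm (transferMatrix f α E θ n) ≤ C * Real.exp (Λ * n) := by
  have hΛ0 : 0 ≤ Λ := (lyapunovExponent_nonneg f α E).trans hΛ.le
  obtain ⟨N, hN, hN0⟩ := (((tendsto_lyapunovExponent f α E).eventually_lt_const hΛ).and
    (eventually_gt_atTop 0)).exists
  have hNpos : (0 : ℝ) < N := by exact_mod_cast hN0
  rw [div_lt_iff₀ hNpos] at hN
  -- Consecutive blocks of length $N$ have phases rotated by $N\alpha$, again irrational, so one $M$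
  -- serves every phase.
  obtain ⟨M, hM, hM0⟩ := ((eventually_sum_rotation_le (hα.natCast_mul hN0.ne')
    ⟨fun θ => Real.log (opNorm (transferMatrix f α E θ N)), continuous_log_opNorm f α E N⟩
    hN).and (eventually_gt_atTop 0)).exists
  have hblock : ∀ θ, opNorm (transferMatrix f α E θ (N * M)) ≤ Real.exp (Λ * (N * M : ℕ)) :=
    fun θ => by
      refine (opNorm_transferMatrix_mul_le f α E N M θ).trans ?_
      have h1 := Real.exp_le_exp.2 (hM θ)
      rw [Real.exp_sum] at h1
      refine le_of_eq_of_le (Finset.prod_congr rfl fun i _ => ?_) (h1.trans_eq ?_)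
      · exact (Real.exp_log (zero_lt_one.trans_le
          (one_le_opNorm _ (det_transferMatrix f α E _ N)))).symm
      · push_cast; ring_nf
  set L := N * M with hL
  have hL0 : 0 < L := Nat.mul_pos hN0 hM0
  choose B hB using exists_opNorm_transferMatrix_le f α E
  have hB0 : ∀ r, 0 ≤ B r := fun r => (opNorm_nonneg _).trans (hB r 0)
  -- The sum dominates the bound $B(n \bmod L)$ for the incomplete last block.
  refine ⟨∑ r ∈ Finset.range L, B r, fun θ n => ?_⟩
  have hpow : ∀ k, opNorm (transferMatrix f α E θ (L * k)) ≤ Real.exp (Λ * (L * k : ℕ)) := by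
    intro k
    induction k with
    | zero => simp [transferMatrix, opNorm_one]
    | succ k ih =>
      rw [mul_add_one, transferMatrix_add, Nat.cast_add, mul_add, Real.exp_add,
        mul_comm (Real.exp _)]
      exact (opNorm_mul_le _ _).trans
        (mul_le_mul (hblock _) ih (opNorm_nonneg _) (Real.exp_pos _).le)
  have hr := Finset.single_le_sum (fun r _ => hB0 r) (Finset.mem_range.2 (Nat.mod_lt n hL0))
  have hexp : Real.exp (Λ * (L * (n / L) : ℕ)) ≤ Real.exp (Λ * n) := by
    gcongr
    exact Nat.mul_div_le n L
  calc opNorm (transferMatrix f α E θ n)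
      = opNorm (transferMatrix f α E θ (L * (n / L) + n % L)) := by rw [Nat.div_add_mod]
    _ ≤ B (n % L) * Real.exp (Λ * (L * (n / L) : ℕ)) := by
        rw [transferMatrix_add]
        exact (opNorm_mul_le _ _).trans
          (mul_le_mul (hB _ _) (hpow _) (opNorm_nonneg _) (hB0 _))
    _ ≤ _ := by
        gcongr
        exact Finset.sum_nonneg fun r _ => hB0 r

/-! ### Stability of transfer matrices in the phase -/

section Stability

variable {f : C(UnitAddCircle, ℝ)} {α E C Λ δ : ℝ}

/-- The extra left factor of length $m$ makes the induction close without loss: bounding the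
remaining steps one at a time would cost a product of one-step norms, whereas the whole tail obeys
the uniform bound. Each of the $n$ telescoping terms has a head and a tail, whence $C^2$ and a
single exponential. The case $m=0$ is the one wanted. -/
lemma opNorm_transferMatrix_mul_sub_le
    (hC : ∀ θ n, opNorm (transferMatrix f α E θ n) ≤ C * Real.exp (Λ * n)) (hΛ : 0 ≤ Λ)
    {θ θ' : UnitAddCircle}
    (hδ : ∀ k : ℕ, |f (θ + k • (α : UnitAddCircle)) - f (θ' + k • (α : UnitAddCircle))| ≤ δ)
    (n m : ℕ) :
    opNorm (transferMatrix f α E (θ + n • (α : UnitAddCircle)) m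
      * (transferMatrix f α E θ n - transferMatrix f α E θ' n))
      ≤ n * (C ^ 2 * Real.exp (Λ * (m + n)) * δ) := by
  induction n generalizing m with
  | zero => simp [transferMatrix, opNorm]
  | succ n ih =>
    have hC0 : 0 ≤ C := by
      have h := (opNorm_nonneg _).trans (hC 0 0)
      simpa using h
    have hδ0 : 0 ≤ δ := (abs_nonneg _).trans (hδ 0)
    -- Writing the length as `1 + m` peels off the rightmost factor, so the step at site $n$ is
    -- absorbed into the tail.
    have h1 : transferMatrix f α E (θ + n • (α : UnitAddCircle)) (1 + m)
        = transferMatrix f α E (θ + (n + 1) • (α : UnitAddCircle)) m * transferStep f α E θ n := by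
      rw [transferMatrix_add, one_smul, add_smul, one_smul, add_assoc]
      simp [transferMatrix, transferStep]
    have h2 : transferStep f α E θ n - transferStep f α E θ' n
        = !![-(f (θ + n • (α : UnitAddCircle)) - f (θ' + n • (α : UnitAddCircle))), 0; 0, 0] := by
      ext i j
      fin_cases i <;> fin_cases j <;> simp [transferStep]
    have h3 : transferMatrix f α E (θ + (n + 1) • (α : UnitAddCircle)) m
        * (transferMatrix f α E θ (n + 1) - transferMatrix f α E θ' (n + 1))
        = transferMatrix f α E (θ + n • (α : UnitAddCircle)) (1 + m)
            * (transferMatrix f α E θ n - transferMatrix f α E θ' n)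
          + transferMatrix f α E (θ + (n + 1) • (α : UnitAddCircle)) m
            * (transferStep f α E θ n - transferStep f α E θ' n) * transferMatrix f α E θ' n := by
      rw [h1, transferMatrix, transferMatrix]
      noncomm_ring
    have h4 : opNorm (transferStep f α E θ n - transferStep f α E θ' n) ≤ δ := by
      rw [h2]
      refine (opNorm_corner_le _).trans ?_
      rw [abs_neg]
      exact hδ n
    have h5 : opNorm (transferMatrix f α E (θ + (n + 1) • (α : UnitAddCircle)) m
        * (transferStep f α E θ n - transferStep f α E θ' n) * transferMatrix f α E θ' n)
        ≤ C * Real.exp (Λ * m) * δ * (C * Real.exp (Λ * n)) := by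
      refine (opNorm_mul_le _ _).trans (mul_le_mul ((opNorm_mul_le _ _).trans
        (mul_le_mul (hC _ _) h4 (opNorm_nonneg _) (by positivity))) (hC _ _)
        (opNorm_nonneg _) (by positivity))
    have h6 : C * Real.exp (Λ * m) * δ * (C * Real.exp (Λ * n))
        ≤ C ^ 2 * Real.exp (Λ * (m + (n + 1))) * δ := by
      have : Real.exp (Λ * m) * Real.exp (Λ * n) ≤ Real.exp (Λ * (m + (n + 1))) := by
        rw [← Real.exp_add]
        exact Real.exp_le_exp.2 (by linarith)
      calc _ = C ^ 2 * (Real.exp (Λ * m) * Real.exp (Λ * n)) * δ := by ring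
        _ ≤ _ := by gcongr
    have h7 := ih (1 + m)
    rw [h3]
    refine (opNorm_add_le _ _).trans ((add_le_add h7 (h5.trans h6)).trans_eq ?_)
    push_cast
    ring_nf

theorem opNorm_transferMatrix_sub_le {K : ℝ≥0} (hf : LipschitzWith K f)
    (hC : ∀ θ n, opNorm (transferMatrix f α E θ n) ≤ C * Real.exp (Λ * n)) (hΛ : 0 ≤ Λ)
    (θ θ' : UnitAddCircle) (n : ℕ) :
    opNorm (transferMatrix f α E θ n - transferMatrix f α E θ' n)
      ≤ n * (C ^ 2 * Real.exp (Λ * n) * (K * dist θ θ')) := by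
  have h := opNorm_transferMatrix_mul_sub_le (δ := K * dist θ θ') (θ := θ) (θ' := θ') hC hΛ
    (fun k => by simpa only [Real.dist_eq, dist_add_right] using
      hf.dist_le_mul (θ + k • (α : UnitAddCircle)) (θ' + k • (α : UnitAddCircle))) n 0
  simpa [transferMatrix] using h

end Stability

lemma norm_nsmul_coe_le (α : ℝ) (p : ℤ) {q : ℕ} (hq : 0 < q) :
    ‖q • (α : UnitAddCircle)‖ ≤ q * |α - p / q| := by
  have hq' : (0 : ℝ) < q := by exact_mod_cast hq
  rw [← AddCircle.coe_nsmul, UnitAddCircle.norm_eq, nsmul_eq_mul]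
  -- The nearest integer to $q\alpha$ is at least as close as $p$.
  refine (round_le _ p).trans_eq ?_
  rw [← abs_of_pos hq', ← abs_mul, abs_of_pos hq', mul_sub, mul_div_cancel₀ _ hq'.ne']

/-! ### Gordon's argument -/

/-- The split is on the size of the trace $t'$. If $|t'|\ge1$, Cayley–Hamilton for $L'$ at $x$ gives
$t'y=x+L'y$, and $L'y$ is within $e\|y\|$ of $z$. If $|t'|\le1$, then $|t|\le1+2e\le2$, and
Cayley–Hamilton for $L$ at $y$ gives $y=tz-Lz$ with $Lz$ within $e\|z\|$ of $w$; this produces the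
coefficient $3\ge2+1/2$. -/
lemma norm_le_of_three_block {V : Type*} [NormedAddCommGroup V] [NormedSpace ℝ V]
    {L L' L'' : V →L[ℝ] V} {t t' e : ℝ} (hL : ∀ v, L (L v) - t • L v + v = 0)
    (hL' : ∀ v, L' (L' v) - t' • L' v + v = 0) (ht : |t - t'| ≤ 2 * e) (he : e ≤ 1 / 2)
    (h1 : ‖L - L'‖ ≤ e) (h2 : ‖L - L''‖ ≤ e) {x y z w : V} (hx : L' x = y) (hy : L y = z)
    (hz : L'' z = w) : ‖y‖ ≤ ‖x‖ + 3 * ‖z‖ + ‖w‖ + e * ‖y‖ := by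
  have he0 : 0 ≤ e := (norm_nonneg _).trans h1
  have hey : 0 ≤ e * ‖y‖ := by positivity
  rcases le_total 1 |t'| with h | h
  · have h3 : t' • y = z - (L - L') y + x := by
      have h := hL' x
      rw [hx, sub_add_eq_add_sub, sub_eq_zero] at h
      rw [← h, sub_apply, hy]
      abel
    have h4 : ‖y‖ ≤ ‖t' • y‖ := by
      rw [norm_smul, Real.norm_eq_abs]
      exact le_mul_of_one_le_left (norm_nonneg y) h
    have h5 := ((L - L').le_opNorm y).trans (mul_le_mul_of_nonneg_right h1 (norm_nonneg y))
    rw [h3] at h4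
    linarith [norm_add_le (z - (L - L') y) x, norm_sub_le z ((L - L') y), norm_nonneg z,
      norm_nonneg w]
  · have h3 : y = t • z - w - (L - L'') z := by
      have h := hL y
      rw [hy] at h
      rw [sub_apply, hz, eq_neg_of_add_eq_zero_right h]
      abel
    have h4 : ‖t • z‖ ≤ 2 * ‖z‖ := by
      rw [norm_smul, Real.norm_eq_abs]
      gcongr
      have := abs_sub_abs_le_abs_sub t t'
      linarith
    have h5 := ((L - L'').le_opNorm z).trans (mul_le_mul_of_nonneg_right h2 (norm_nonneg z))
    have h6 : e * ‖z‖ ≤ 1 / 2 * ‖z‖ := by gcongr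
    have h7 : ‖y‖ ≤ ‖t • z‖ + ‖w‖ + ‖(L - L'') z‖ := by
      conv_lhs => rw [h3]
      linarith [norm_sub_le (t • z - w) ((L - L'') z), norm_sub_le (t • z) w]
    linarith [norm_nonneg x, norm_nonneg z]

/-- The state `(u(n), u(n-1))` of a sequence at site `n`. -/
noncomputable def stateVector (u : ℤ → ℝ) (n : ℤ) : EuclideanSpace ℝ (Fin 2) :=
  !₂[u n, u (n - 1)]

lemma toEuclideanCLM_transferMatrix_stateVector {f : C(UnitAddCircle, ℝ)} {α E : ℝ}
    {θ : UnitAddCircle} {u : ℤ → ℝ}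
    (hu : ∀ n : ℤ, u (n - 1) + u (n + 1) + f (θ + n • (α : UnitAddCircle)) * u n = E * u n)
    (k : ℤ) (n : ℕ) :
    Matrix.toEuclideanCLM (n := Fin 2) (𝕜 := ℝ)
      (transferMatrix f α E (θ + k • (α : UnitAddCircle)) n) (stateVector u k)
      = stateVector u (k + n) := by
  induction n with
  | zero => simp [transferMatrix]
  | succ n ih =>
    rw [transferMatrix, map_mul, mul_apply_eq_comp, ih]
    have h := hu (k + n)
    rw [add_smul, natCast_zsmul, ← add_assoc] at h
    ext i
    fin_cases i
    · simp [stateVector, transferStep, ← add_assoc]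
      linarith
    · simp [stateVector, transferStep, ← add_assoc]

/-- Fractions with bounded denominator stay a positive distance from an irrational number. -/
lemma tendsto_atTop_of_tendsto_div_irrational {α : ℝ} (hα : Irrational α) {p : ℕ → ℤ} {q : ℕ → ℕ}
    (hlim : Tendsto (fun m => (p m : ℝ) / (q m : ℝ)) atTop (𝓝 α)) : Tendsto q atTop atTop := by
  refine tendsto_atTop.2 fun n => ?_
  obtain ⟨ε, h, hε⟩ := ((hα.eventually_forall_le_dist_cast_div_of_denom_le n).filter_mono
    nhdsWithin_le_nhds |>.and self_mem_nhdsWithin : ∀ᶠ ε in 𝓝[>] (0 : ℝ), _ ∧ ε ∈ Set.Ioi 0).exists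
  filter_upwards [hlim.eventually (Metric.ball_mem_nhds α hε)] with m hm
  by_contra! hlt
  have := h (q m) hlt.le (p m)
  rw [dist_comm] at this
  exact absurd hm (not_lt.2 this)

/-- Sharp Gordon lemma: exponentially good periodic approximation at a rate above the growth rate of
the transfer matrices excludes decaying solutions of the eigenvalue equation. -/
theorem eq_zero_of_tendsto_zero_of_approx {f : C(UnitAddCircle, ℝ)} {K : ℝ≥0}
    (hf : LipschitzWith K f) {α : ℝ} (hα : Irrational α) {p : ℕ → ℤ} {q : ℕ → ℕ}
    (hq : ∀ m, 0 < q m) (hlim : Tendsto (fun m => (p m : ℝ) / (q m : ℝ)) atTop (𝓝 α)) {β : ℝ}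
    (happrox : ∀ m, |α - (p m : ℝ) / (q m : ℝ)| < Real.exp (-β * (q m : ℝ))) {E : ℝ}
    (hE : lyapunovExponent f α E < β) {θ : UnitAddCircle} {u : ℤ → ℝ}
    (hu : ∀ n : ℤ, u (n - 1) + u (n + 1) + f (θ + n • (α : UnitAddCircle)) * u n = E * u n)
    (hu0 : Tendsto u cofinite (𝓝 0)) : u 0 = 0 := by
  obtain ⟨Λ, hγΛ, hΛβ⟩ := exists_between hE
  have hΛ : 0 ≤ Λ := (lyapunovExponent_nonneg f α E).trans hγΛ.le
  obtain ⟨C, hC⟩ := exists_forall_opNorm_transferMatrix_le f hα E hγΛ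
  have hqtop := tendsto_atTop_of_tendsto_div_irrational hα hlim
  set a : UnitAddCircle := (α : UnitAddCircle) with ha
  -- One factor $q$ counts the telescoping terms; the other comes from $\|q\alpha\|\le
  -- q\,|\alpha-p/q|$.
  set e : ℕ → ℝ := fun m => C ^ 2 * K * ((q m : ℝ) ^ 2 * Real.exp (-(β - Λ) * q m)) with he
  have he0 : Tendsto e atTop (𝓝 0) := by
    have h1 : Tendsto (fun x : ℝ => x ^ 2 * Real.exp (-(β - Λ) * x)) atTop (𝓝 0) := by
      simpa using tendsto_rpow_mul_exp_neg_mul_atTop_nhds_zero 2 (β - Λ) (sub_pos.2 hΛβ)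
    simpa only [mul_zero, Function.comp_def] using
      ((h1.comp tendsto_natCast_atTop_atTop).comp hqtop).const_mul (C ^ 2 * K)
  have hclose : ∀ m (θ₁ θ₂ : UnitAddCircle), dist θ₁ θ₂ = ‖q m • a‖ →
      opNorm (transferMatrix f α E θ₁ (q m) - transferMatrix f α E θ₂ (q m)) ≤ e m := by
    intro m θ₁ θ₂ hd
    have h1 := opNorm_transferMatrix_sub_le hf hC hΛ θ₁ θ₂ (q m)
    have h2 : dist θ₁ θ₂ ≤ q m * Real.exp (-β * q m) := by
      rw [hd]
      exact (norm_nsmul_coe_le α (p m) (hq m)).trans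
        (mul_le_mul_of_nonneg_left (happrox m).le (Nat.cast_nonneg _))
    calc _ ≤ _ := h1
      _ ≤ q m * (C ^ 2 * Real.exp (Λ * q m) * (K * (q m * Real.exp (-β * q m)))) := by gcongr
      _ = C ^ 2 * K * (q m ^ 2 * (Real.exp (Λ * q m) * Real.exp (-β * q m))) := by ring
      _ = e m := by
        rw [← Real.exp_add]
        simp only [he]
        ring_nf
  have hstate : ∀ k : ℕ → ℤ, Tendsto k atTop cofinite → Tendsto (fun m => k m - 1) atTop cofinite →
      Tendsto (fun m => ‖stateVector u (k m)‖) atTop (𝓝 0) := by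
    intro k hk hk'
    have h1 := ((hu0.comp hk).pow 2).add ((hu0.comp hk').pow 2)
    have h2 := (Real.continuous_sqrt.tendsto _).comp h1
    simpa [Function.comp_def, stateVector, EuclideanSpace.norm_eq, Fin.sum_univ_two] using h2
  have hsite : ∀ c : ℤ, c ≠ 0 →
      Tendsto (fun m => ‖stateVector u (c * q m)‖) atTop (𝓝 0) := by
    intro c hc
    have hqz : Tendsto (fun m => (q m : ℤ)) atTop cofinite :=
      (Nat.cast_injective.tendsto_cofinite).comp (Nat.cofinite_eq_atTop ▸ hqtop)
    have h1 := (mul_right_injective₀ hc).tendsto_cofinite.comp hqz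
    exact hstate _ h1 ((sub_left_injective (b := (1 : ℤ))).tendsto_cofinite.comp h1)
  have hbound : ∀ᶠ m in atTop, ‖stateVector u 0‖ ≤ ‖stateVector u (-1 * q m)‖
      + 3 * ‖stateVector u (1 * q m)‖ + ‖stateVector u (2 * q m)‖ + e m * ‖stateVector u 0‖ := by
    filter_upwards [he0.eventually_le_const (by norm_num : (0 : ℝ) < 1 / 2)] with m hm
    set A := transferMatrix f α E θ (q m)
    set A' := transferMatrix f α E (θ + (-1 * q m : ℤ) • a) (q m)
    set A'' := transferMatrix f α E (θ + (1 * q m : ℤ) • a) (q m)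
    have hA' : opNorm (A - A') ≤ e m := hclose m _ _ (by simp [dist_eq_norm])
    have hA'' : opNorm (A - A'') ≤ e m := hclose m _ _ (by simp [dist_eq_norm])
    have hCH : ∀ B : Matrix (Fin 2) (Fin 2) ℝ, B.det = 1 → ∀ v,
        Matrix.toEuclideanCLM (n := Fin 2) (𝕜 := ℝ) B
          (Matrix.toEuclideanCLM (n := Fin 2) (𝕜 := ℝ) B v)
        - B.trace • Matrix.toEuclideanCLM (n := Fin 2) (𝕜 := ℝ) B v + v = 0 := fun B hB v => by
      have h := congrArg (fun M => Matrix.toEuclideanCLM (n := Fin 2) (𝕜 := ℝ) M v)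
        (mul_self_sub_trace_smul_add_one B hB)
      simpa only [map_add, map_sub, map_mul, map_smul, map_one, map_zero,
        add_apply, sub_apply,
        mul_apply_eq_comp, smul_apply,
        one_apply_eq_self, zero_apply] using h
    refine norm_le_of_three_block (hCH A (det_transferMatrix ..)) (hCH A' (det_transferMatrix ..))
      (t := A.trace) (t' := A'.trace) (L'' := Matrix.toEuclideanCLM (n := Fin 2) (𝕜 := ℝ) A'')
      ?_ hm ?_ ?_ ?_ ?_ ?_
    · rw [← Matrix.trace_sub]
      exact (abs_trace_le_opNorm _).trans (by gcongr)
    · rw [← map_sub]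
      exact hA'
    · rw [← map_sub]
      exact hA''
    · rw [toEuclideanCLM_transferMatrix_stateVector hu]
      simp
    · simpa using toEuclideanCLM_transferMatrix_stateVector hu 0 (q m)
    · rw [toEuclideanCLM_transferMatrix_stateVector hu]
      congr 1
      ring
  have hrhs : Tendsto (fun m => ‖stateVector u (-1 * q m)‖ + 3 * ‖stateVector u (1 * q m)‖
      + ‖stateVector u (2 * q m)‖ + e m * ‖stateVector u 0‖) atTop (𝓝 0) := by
    simpa using (((hsite (-1) (by norm_num)).add ((hsite 1 one_ne_zero).const_mul 3)).add
      (hsite 2 two_ne_zero)).add (he0.mul_const ‖stateVector u 0‖)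
  have hzero : stateVector u 0 = 0 := norm_le_zero_iff.1 (ge_of_tendsto hrhs hbound)
  simpa [stateVector] using congrArg (fun v : EuclideanSpace ℝ (Fin 2) => v 0) hzero

lemma tendsto_cofinite_zero_L2Z (ψ : L2Z) : Tendsto (fun n => ψ n) cofinite (𝓝 0) := by
  have h := ((memℓp_gen_iff (p := 2) (by norm_num)).1 (lp.memℓp ψ)).tendsto_cofinite_zero
  have h2 := (Real.continuous_sqrt.tendsto _).comp h
  rw [tendsto_zero_iff_norm_tendsto_zero]
  simpa [Function.comp_def] using h2

/-- Under exponentially good periodic approximation, at a rate above the Lyapunov exponent at `E`,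
the eigenvalue equation at `E` has no nonzero solution in `ℓ²(ℤ)`. -/
theorem eq_zero_of_hamiltonian_eq_smul {f : C(UnitAddCircle, ℝ)} {K : ℝ≥0}
    (hf : LipschitzWith K f) {α : ℝ} (hα : Irrational α) {p : ℕ → ℤ} {q : ℕ → ℕ}
    (hq : ∀ m, 0 < q m) (hlim : Tendsto (fun m => (p m : ℝ) / (q m : ℝ)) atTop (𝓝 α)) {β : ℝ}
    (happrox : ∀ m, |α - (p m : ℝ) / (q m : ℝ)| < Real.exp (-β * (q m : ℝ))) {E : ℝ}
    (hE : lyapunovExponent f α E < β) {θ : UnitAddCircle} {ψ : L2Z}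
    (hψ : hamiltonian f α θ ψ = (E : ℂ) • ψ) : ψ = 0 := by
  ext k
  have heq : ∀ n : ℤ, ψ (n - 1) + ψ (n + 1) + (f (θ + n • (α : UnitAddCircle)) : ℂ) * ψ n
      = E * ψ n := fun n => by
    rw [← hamiltonian_apply, hψ]
    rfl
  -- Gordon's lemma controls only the value at site $0$ but holds for every phase, so site $k$ is
  -- moved to $0$ by replacing $\theta$ with $\theta+k\alpha$. The coefficients are real, so real
  -- and imaginary parts solve the equation separately.
  have hlim0 : Tendsto (fun n => ψ (k + n)) cofinite (𝓝 0) :=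
    (tendsto_cofinite_zero_L2Z ψ).comp (add_right_injective k).tendsto_cofinite
  have hshift : ∀ n : ℤ, ψ (k + (n - 1)) + ψ (k + (n + 1))
      + (f ((θ + k • (α : UnitAddCircle)) + n • (α : UnitAddCircle)) : ℂ) * ψ (k + n)
      = E * ψ (k + n) := fun n => by
    have h := heq (k + n)
    rwa [add_smul, ← add_assoc θ, add_sub_assoc, add_assoc k] at h
  have hre := eq_zero_of_tendsto_zero_of_approx hf hα hq hlim happrox hE
    (θ := θ + k • (α : UnitAddCircle)) (u := fun n => (ψ (k + n)).re)
    (fun n => by simpa using congrArg Complex.re (hshift n))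
    (by simpa [Function.comp_def] using (Complex.continuous_re.tendsto 0).comp hlim0)
  have him := eq_zero_of_tendsto_zero_of_approx hf hα hq hlim happrox hE
    (θ := θ + k • (α : UnitAddCircle)) (u := fun n => (ψ (k + n)).im)
    (fun n => by simpa using congrArg Complex.im (hshift n))
    (by simpa [Function.comp_def] using (Complex.continuous_im.tendsto 0).comp hlim0)
  rw [add_zero] at hre him
  exact Complex.ext hre him

end QPSchrodinger

theorem mainTheorem3
    (f : C(UnitAddCircle, ℝ)) (hf : ∃ K : ℝ≥0, LipschitzWith K f)
    (α : ℝ) (hα : Irrational α)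
    (p : ℕ → ℤ) (q : ℕ → ℕ) (hq : ∀ m, 0 < q m)
    (hlim : Tendsto (fun m => (p m : ℝ) / (q m : ℝ)) atTop (𝓝 α))
    (β : ℝ) (hβ : 0 < β)
    (happrox : ∀ m, |α - (p m : ℝ) / (q m : ℝ)| < Real.exp (-β * (q m : ℝ)))
    (E : ℝ) (hE : 2 * QPSchrodinger.lyapunovExponent f α E < β) :
    (∀ θ : UnitAddCircle,
      ¬ Module.End.HasEigenvalue (QPSchrodinger.hamiltonian f α θ).toLinearMap (E : ℂ)) ∧
    (⨆ θ : UnitAddCircle, QPSchrodinger.canonicalSpectralMeasure f α θ {E}) = 0 := by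
  obtain ⟨K, hK⟩ := hf
  have hγ : QPSchrodinger.lyapunovExponent f α E < β := by
    linarith [QPSchrodinger.lyapunovExponent_nonneg f α E]
  have hker : ∀ (θ : UnitAddCircle) (ψ : QPSchrodinger.L2Z),
      QPSchrodinger.hamiltonian f α θ ψ = (E : ℂ) • ψ → ψ = 0 := fun θ ψ hψ =>
    QPSchrodinger.eq_zero_of_hamiltonian_eq_smul hK hα hq hlim happrox hγ hψ
  refine ⟨fun θ h => ?_, ?_⟩
  · obtain ⟨ψ, hψ⟩ := h.exists_hasEigenvector
    exact hψ.2 (hker θ ψ hψ.apply_eq_smul)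
  · refine ENNReal.iSup_eq_zero.2 fun θ => ?_
    rw [QPSchrodinger.canonicalSpectralMeasure, Measure.add_apply, add_eq_zero]
    exact ⟨QPSchrodinger.spectralMeasure_singleton_eq_zero _ _ _ E (hker θ),
      QPSchrodinger.spectralMeasure_singleton_eq_zero _ _ _ E (hker θ)⟩
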